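/- Let $A=(a_{ij})_{i,j\in\mathcal I}$ be an indecomposable generalized Cartan matrix of finite or affine type, and let $\mathfrak g=\mathfrak g(A)$ be the corresponding Lie algebra over $\mathbb C$ (a finite-dimensional simple Lie algebra, respectively an affine Kac--Moody algebra), with Cartan subalgebra $\mathfrak h$, linearly independent simple roots $\alpha_i\in\mathfrak h^*$ $(i\in\mathcal I)$, root spaces $\mathfrak g_\beta=\{x\in\mathfrak g : [h,x]=\beta(h)x\ \ \forall h\in\mathfrak h\}$, set of roots $\Delta=\{\beta\in\mathfrak h^*\setminus\{0\} : \mathfrak g_\beta\neq 0\}$ and set of positive roots $\Delta^+=\Delta\cap\sum_{i}\mathbb Z_{\ge 0}\,\alpha_i$. For a nonempty subset $I\subseteq\mathcal I$ and $x=\sum_{i\in\mathcal I}c_i\alpha_i$ with $c_i\in\mathbb C$, put $\mathrm{ht}_I(x)=\sum_{i\in I}c_i$, and let $\Delta_{I,1}=\{\gamma\in\Delta : \mathrm{ht}_I(\gamma)=1\}$. **Theorem.** Let $\emptyset\neq I\subseteq\mathcal I$, and let $\beta\in\Delta^+$ with $m:=\mathrm{ht}_I(\beta)>0$. Then the root space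 $\mathfrak g_\beta$ is the $\mathbb C$-linear span of the right-normed Lie words $$\big[e_{\gamma_m},[\cdots,[e_{\gamma_2},e_{\gamma_1}]\cdots]\big]$$ where $\gamma_t\in\Delta_{I,1}$ and $e_{\gamma_t}\in\mathfrak g_{\gamma_t}$ for all $1\le t\le m$, and $\sum_{t=1}^m\gamma_t=\beta$. (For $m=1$ the word is $e_{\gamma_1}$.) -/

import Mathlib

noncomputable section

namespace KacMoody

variable {ι : Type*} [Fintype ι]

/-! ### Generalized Cartan matrices of finite and affine type -/

/-- Generalized Cartan matrices. -/
structure IsGCM (A : Matrix ι ι ℤ) : Prop where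
  diag : ∀ i, A i i = 2
  nonpos : ∀ i j, i ≠ j → A i j ≤ 0
  zero_symm : ∀ i j, A i j = 0 → A j i = 0

/-- `A` is not block diagonal with respect to a partition of the index set into two
nonempty parts. -/
def IsIndecomposable (A : Matrix ι ι ℤ) : Prop :=
  ∀ S : Set ι, S.Nonempty → Sᶜ.Nonempty → ∃ i ∈ S, ∃ j ∈ Sᶜ, A i j ≠ 0 ∨ A j i ≠ 0

/-- An integer matrix acting on real column vectors. -/
def act (A : Matrix ι ι ℤ) (v : ι → ℝ) : ι → ℝ :=
  (A.map (Int.cast : ℤ → ℝ)).mulVec v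

/-- Indecomposable generalized Cartan matrices of finite type, that is, the Cartan matrices of
the complex finite-dimensional simple Lie algebras. -/
structure IsFiniteType (A : Matrix ι ι ℤ) : Prop where
  gcm : IsGCM A
  indecomposable : IsIndecomposable A
  nondegenerate : ∀ v : ι → ℝ, act A v = 0 → v = 0
  exists_pos : ∃ u : ι → ℝ, (∀ i, 0 < u i) ∧ ∀ i, 0 < act A u i
  pos_or_zero : ∀ v : ι → ℝ, (∀ i, 0 ≤ act A v i) → (∀ i, 0 < v i) ∨ v = 0

/-- Indecomposable generalized Cartan matrices of affine type. -/
structure IsAffineType (A : Matrix ι ι ℤ) : Prop where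
  gcm : IsGCM A
  indecomposable : IsIndecomposable A
  corank_one : (A.map (Int.cast : ℤ → ℝ)).rank + 1 = Fintype.card ι
  exists_null : ∃ u : ι → ℝ, (∀ i, 0 < u i) ∧ act A u = 0
  nonneg_zero : ∀ v : ι → ℝ, (∀ i, 0 ≤ act A v i) → act A v = 0

/-! ### Realizations and the Kac-Moody algebra -/

/-- A (minimal) realization of `A` over `ℂ`: linearly independent simple roots and simple
coroots in `𝔥*` and `𝔥`, paired by `A`, with `dim 𝔥 = 2 n - rank A`, where `n` is the size
of `A`. -/
structure Realization (A : Matrix ι ι ℤ) (𝔥 : Type*) [AddCommGroup 𝔥] [Module ℂ 𝔥] where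
  finiteDimensional : FiniteDimensional ℂ 𝔥
  simpleRoot : ι → Module.Dual ℂ 𝔥
  simpleCoroot : ι → 𝔥
  linearIndependent_simpleRoot : LinearIndependent ℂ simpleRoot
  linearIndependent_simpleCoroot : LinearIndependent ℂ simpleCoroot
  pairing : ∀ i j, simpleRoot j (simpleCoroot i) = (A i j : ℂ)
  finrank_add_rank :
    Module.finrank ℂ 𝔥 + (A.map (Int.cast : ℤ → ℂ)).rank = 2 * Fintype.card ι

/-- Generators of the Kac-Moody algebra: the elements of `𝔥` and the `e i`, `f i`. -/
inductive Gen (ι : Type*) (𝔥 : Type*)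
  | h : 𝔥 → Gen ι 𝔥
  | e : ι → Gen ι 𝔥
  | f : ι → Gen ι 𝔥

variable {A : Matrix ι ι ℤ} {𝔥 : Type*} [AddCommGroup 𝔥] [Module ℂ 𝔥]

namespace Realization

variable (R : Realization A 𝔥)

variable (ι) in
/-- The generator of the free Lie algebra attached to `x ∈ 𝔥`. -/
abbrev genH (x : 𝔥) : FreeLieAlgebra ℂ (Gen ι 𝔥) := FreeLieAlgebra.of ℂ (Gen.h x)

variable (𝔥) in
/-- The generator `e i` of the free Lie algebra. -/
abbrev genE (i : ι) : FreeLieAlgebra ℂ (Gen ι 𝔥) := FreeLieAlgebra.of ℂ (Gen.e i)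

variable (𝔥) in
/-- The generator `f i` of the free Lie algebra. -/
abbrev genF (i : ι) : FreeLieAlgebra ℂ (Gen ι 𝔥) := FreeLieAlgebra.of ℂ (Gen.f i)

/-- The defining relators of the auxiliary Lie algebra `g̃(A)`. -/
inductive Relator : FreeLieAlgebra ℂ (Gen ι 𝔥) → Prop
  | add (x y : 𝔥) : Relator (genH ι (x + y) - (genH ι x + genH ι y))
  | smul (c : ℂ) (x : 𝔥) : Relator (genH ι (c • x) - c • genH ι x)
  | hh (x y : 𝔥) : Relator ⁅genH ι x, genH ι y⁆
  | ef_same (i : ι) : Relator (⁅genE 𝔥 i, genF 𝔥 i⁆ - genH ι (R.simpleCoroot i))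
  | ef_ne (i j : ι) (hij : i ≠ j) : Relator ⁅genE 𝔥 i, genF 𝔥 j⁆
  | he (x : 𝔥) (i : ι) : Relator (⁅genH ι x, genE 𝔥 i⁆ - R.simpleRoot i x • genE 𝔥 i)
  | hf (x : 𝔥) (i : ι) : Relator (⁅genH ι x, genF 𝔥 i⁆ + R.simpleRoot i x • genF 𝔥 i)

/-- The ideal generated by the relators. -/
def relIdeal : LieIdeal ℂ (FreeLieAlgebra ℂ (Gen ι 𝔥)) :=
  LieSubmodule.lieSpan ℂ _ {x | R.Relator x}

/-- The auxiliary Lie algebra `g̃(A)`. -/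
abbrev Aux : Type _ := FreeLieAlgebra ℂ (Gen ι 𝔥) ⧸ R.relIdeal

/-- The image in `g̃(A)` of an element of `𝔥`. -/
def auxCartan (x : 𝔥) : R.Aux := LieSubmodule.Quotient.mk' R.relIdeal (genH ι x)

/-- The largest ideal of `g̃(A)` that intersects `𝔥` trivially: the sum of all such ideals. -/
def maxIdeal : LieIdeal ℂ R.Aux :=
  sSup {J | ∀ x : 𝔥, R.auxCartan x ∈ J → R.auxCartan x = 0}

/-- The Kac-Moody algebra `g(A)`. -/
abbrev Algebra : Type _ := R.Aux ⧸ R.maxIdeal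

/-- The image in `g(A)` of an element of `𝔥`. -/
def cartan (x : 𝔥) : R.Algebra := LieSubmodule.Quotient.mk' R.maxIdeal (R.auxCartan x)

/-- The root space `g_β = {x ∈ g | [h, x] = β(h) x for all h ∈ 𝔥}`. -/
def rootSpace (β : Module.Dual ℂ 𝔥) : Submodule ℂ R.Algebra where
  carrier := {x | ∀ h : 𝔥, ⁅R.cartan h, x⁆ = β h • x}
  add_mem' := by
    intro x y hx hy h
    rw [lie_add, hx h, hy h, smul_add]
  zero_mem' := by
    intro h
    rw [lie_zero, smul_zero]
  smul_mem' := by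
    intro c x hx h
    rw [lie_smul, hx h, smul_comm]

/-- The set `Δ` of roots. -/
def roots : Set (Module.Dual ℂ 𝔥) := {β | β ≠ 0 ∧ R.rootSpace β ≠ ⊥}

/-- The set `Δ⁺` of positive roots. -/
def posRoots : Set (Module.Dual ℂ 𝔥) :=
  {β | β ∈ R.roots ∧ ∃ c : ι → ℕ, β = ∑ i, c i • R.simpleRoot i}

open Classical in
/-- The coefficient of the simple root `α i` in `x`, for `x` in the span of the simple roots
(all roots are); it is set to `0` outside that span. -/
def coeff (x : Module.Dual ℂ 𝔥) (i : ι) : ℂ :=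
  if hx : x ∈ Submodule.span ℂ (Set.range R.simpleRoot) then
    R.linearIndependent_simpleRoot.repr ⟨x, hx⟩ i
  else 0

/-- The `I`-height: the sum of the coefficients of the simple roots indexed by `I`. -/
def heightOn (I : Finset ι) (x : Module.Dual ℂ 𝔥) : ℂ := ∑ i ∈ I, R.coeff x i

/-- `Δ_{I,1}`: the roots of `I`-height one. -/
def unitRoots (I : Finset ι) : Set (Module.Dual ℂ 𝔥) :=
  {β | β ∈ R.roots ∧ R.heightOn I β = 1}

/-- `heightOn` computes the expected number. -/
theorem heightOn_sum (I : Finset ι) (c : ι → ℂ) :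
    R.heightOn I (∑ i, c i • R.simpleRoot i) = ∑ i ∈ I, c i := by
  have hmem : ∑ i, c i • R.simpleRoot i ∈ Submodule.span ℂ (Set.range R.simpleRoot) :=
    Submodule.sum_mem _ fun i _ =>
      Submodule.smul_mem _ _ (Submodule.subset_span (Set.mem_range_self i))
  have hrepr : R.linearIndependent_simpleRoot.repr ⟨_, hmem⟩
      = Finsupp.equivFunOnFinite.symm c := by
    apply R.linearIndependent_simpleRoot.repr_eq
    rw [Finsupp.linearCombination_apply, Finsupp.sum_fintype _ _ (by simp)]
    rfl
  unfold heightOn coeff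
  refine Finset.sum_congr rfl fun i _ => ?_
  rw [dif_pos hmem, hrepr]
  rfl

end Realization

/-- The right normed Lie word `[x_m, [⋯, [x_2, x_1] ⋯]]` of `x_1, …, x_m` (it is `x_1` for
`m = 1`; the empty word is set to `0`). -/
def rightNormedWord {L : Type*} [LieRing L] : (m : ℕ) → (Fin m → L) → L
  | 0, _ => 0
  | 1, x => x 0
  | (k + 2), x => ⁅x (Fin.last (k + 1)), rightNormedWord (k + 1) fun t => x t.castSucc⁆

end KacMoody

end

noncomputable section

namespace KacMoody

/-! The algebra is spanned by `𝔥`, the right-normed words in the `e i` and those in the `f i`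
(`cartan_sup_wordSpan_eq_top`). Weight spaces are independent, so a spanning family of weight
vectors spans each weight space separately; in a nonzero weight of the positive cone only `e`-words
survive (`rootSpace_eq_span_words`).

It remains to regroup an `e`-word into letters of `I`-height one, by induction from the innermost
letter (`weightedWord_mem_span_unitWord`). While the height is zero nothing is claimed; the first
letter with index in `I` turns the whole bracket so far into one new letter. After that, `e i` with
`i ∈ I` is a new outer letter, and `e i` with `i ∉ I` acts as a derivation, absorbed by one letter
at a time without changing its height (`chevalleyE_lie_unitWord`). A letter whose weight is not a
root is zero and kills its word (`UnitWord.eq_zero_or_exists`). -/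

/-! ### Weighted words and independence of simultaneous eigenspaces -/

/-- The right normed words in the elements `x i`, together with their weights, when the letter
`x i` has weight `a i`. -/
inductive WeightedWord {ι V L : Type*} [AddCommGroup V] [LieRing L] (a : ι → V) (x : ι → L) :
    V → L → Prop
  | letter (i : ι) : WeightedWord a x (a i) (x i)
  | lie (i : ι) {γ : V} {w : L} : WeightedWord a x γ w → WeightedWord a x (a i + γ) ⁅x i, w⁆

/-- The coefficients count the letters. That they are not all zero is what later keeps `f`-words out
of the positive cone. -/
theorem WeightedWord.exists_weight_eq_sum {ι V L : Type*} [Fintype ι] [AddCommGroup V] [LieRing L]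
    {a : ι → V} {x : ι → L} {γ : V} {w : L} (hw : WeightedWord a x γ w) :
    ∃ c : ι → ℕ, c ≠ 0 ∧ γ = ∑ i, c i • a i := by
  classical
  have single (i : ι) : ∑ j, (Pi.single i 1 : ι → ℕ) j • a j = a i := by
    simp [Pi.single_apply, ite_smul]
  induction hw with
  | letter i => exact ⟨Pi.single i 1, by simp, (single i).symm⟩
  | lie i _ ih =>
    obtain ⟨c, -, rfl⟩ := ih
    refine ⟨Pi.single i 1 + c, fun h => ?_, ?_⟩
    · simpa using congrFun h i
    · simp only [Pi.add_apply, add_smul, Finset.sum_add_distrib, single]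

theorem lie_mem_of_mem_span {L : Type*} [LieRing L] [LieAlgebra ℂ L] {x y : L} {S : Set L}
    {N : Submodule ℂ L} (h : ∀ z ∈ S, ⁅x, z⁆ ∈ N) (hy : y ∈ Submodule.span ℂ S) : ⁅x, y⁆ ∈ N :=
  (Submodule.span_le (p := N.comap (LieAlgebra.ad ℂ L x : L →ₗ[ℂ] L))).2 h hy

/-- The operators `ad (φ h)` commute by the Jacobi identity, so their simultaneous generalized
eigenspaces are independent, and each `W β` lies in one of them. -/
theorem iSupIndep_of_lie_eq_smul {L 𝔥 : Type*} [LieRing L] [LieAlgebra ℂ L] [AddCommGroup 𝔥]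
    [Module ℂ 𝔥] (φ : 𝔥 → L) (hφ : ∀ h k, ⁅φ h, φ k⁆ = 0) (W : Module.Dual ℂ 𝔥 → Submodule ℂ L)
    (hW : ∀ β, ∀ x ∈ W β, ∀ h, ⁅φ h, x⁆ = β h • x) : iSupIndep W := by
  let f (h : 𝔥) : Module.End ℂ L := LieModule.toEnd ℂ L L (φ h)
  have hcomm (h k : 𝔥) : Commute (f k) (f h) := by
    refine LinearMap.ext fun x => ?_
    change ⁅φ k, ⁅φ h, x⁆⁆ = ⁅φ h, ⁅φ k, x⁆⁆
    rw [leibniz_lie, hφ, zero_lie, zero_add]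
  have hindep := Module.End.independent_iInf_maxGenEigenspace_of_forall_mapsTo f
    fun h k c => Module.End.mapsTo_maxGenEigenspace_of_comm (hcomm h k) c
  refine (hindep.comp (f := fun β : Module.Dual ℂ 𝔥 => (β : 𝔥 → ℂ)) DFunLike.coe_injective).mono
    fun β x hx => ?_
  refine (Submodule.mem_iInf _).2 fun h => ?_
  exact Module.End.genEigenspace_le_maximal _ _ 1
    (Module.End.mem_eigenspace_iff.2 (hW β x hx h))

namespace Realization

variable {ι : Type*} [Fintype ι] {A : Matrix ι ι ℤ} {𝔥 : Type*} [AddCommGroup 𝔥] [Module ℂ 𝔥]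
variable (R : Realization A 𝔥)

/-! ### Generators of the Kac-Moody algebra -/

/-- The projection of the free Lie algebra onto `g(A)`. -/
def proj : FreeLieAlgebra ℂ (Gen ι 𝔥) →ₗ⁅ℂ⁆ R.Algebra where
  toFun z := LieSubmodule.Quotient.mk' R.maxIdeal (LieSubmodule.Quotient.mk' R.relIdeal z)
  map_add' _ _ := rfl
  map_smul' _ _ := rfl
  map_lie' := rfl

theorem proj_surjective : Function.Surjective R.proj :=
  (LieSubmodule.Quotient.surjective_mk' _).comp (LieSubmodule.Quotient.surjective_mk' _)

/-- The Chevalley generator `e i` of `g(A)`. -/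
def chevalleyE (i : ι) : R.Algebra := R.proj (genE 𝔥 i)

/-- The Chevalley generator `f i` of `g(A)`. -/
def chevalleyF (i : ι) : R.Algebra := R.proj (genF 𝔥 i)

theorem proj_genH (x : 𝔥) : R.proj (genH ι x) = R.cartan x := rfl

theorem proj_eq_zero {z : FreeLieAlgebra ℂ (Gen ι 𝔥)} (hz : R.Relator z) : R.proj z = 0 := by
  have h : LieSubmodule.Quotient.mk' R.relIdeal z = 0 :=
    (LieSubmodule.Quotient.mk_eq_zero _).2 (LieSubmodule.subset_lieSpan hz)
  change LieSubmodule.Quotient.mk' R.maxIdeal (LieSubmodule.Quotient.mk' R.relIdeal z) = 0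
  rw [h, map_zero]

theorem cartan_lie_cartan (x y : 𝔥) : ⁅R.cartan x, R.cartan y⁆ = 0 := by
  simpa only [LieHom.map_lie, proj_genH] using R.proj_eq_zero (.hh x y)

theorem cartan_lie_chevalleyE (x : 𝔥) (i : ι) :
    ⁅R.cartan x, R.chevalleyE i⁆ = R.simpleRoot i x • R.chevalleyE i := by
  have h := R.proj_eq_zero (.he x i)
  rwa [map_sub, map_smul, LieHom.map_lie, proj_genH, sub_eq_zero] at h

theorem cartan_lie_chevalleyF (x : 𝔥) (i : ι) :
    ⁅R.cartan x, R.chevalleyF i⁆ = -(R.simpleRoot i x • R.chevalleyF i) := by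
  have h := R.proj_eq_zero (.hf x i)
  rwa [map_add, map_smul, LieHom.map_lie, proj_genH, add_eq_zero_iff_eq_neg] at h

theorem chevalleyE_lie_chevalleyF_same (i : ι) :
    ⁅R.chevalleyE i, R.chevalleyF i⁆ = R.cartan (R.simpleCoroot i) := by
  have h := R.proj_eq_zero (.ef_same i)
  rwa [map_sub, LieHom.map_lie, proj_genH, sub_eq_zero] at h

theorem chevalleyE_lie_chevalleyF_ne {i j : ι} (hij : i ≠ j) :
    ⁅R.chevalleyE i, R.chevalleyF j⁆ = 0 := by
  have h := R.proj_eq_zero (.ef_ne i j hij)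
  rwa [LieHom.map_lie] at h

theorem chevalleyE_lie_chevalleyF_mem (i j : ι) :
    ⁅R.chevalleyE i, R.chevalleyF j⁆ ∈ Submodule.span ℂ (Set.range R.cartan) := by
  by_cases hij : i = j
  · subst hij
    rw [chevalleyE_lie_chevalleyF_same]
    exact Submodule.subset_span ⟨_, rfl⟩
  · rw [R.chevalleyE_lie_chevalleyF_ne hij]
    exact Submodule.zero_mem _

theorem chevalleyF_lie_chevalleyE_mem (i j : ι) :
    ⁅R.chevalleyF i, R.chevalleyE j⁆ ∈ Submodule.span ℂ (Set.range R.cartan) := by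
  rw [← lie_skew]
  exact Submodule.neg_mem _ (R.chevalleyE_lie_chevalleyF_mem j i)

/-- A Lie subalgebra of `g(A)` that contains the generators is the whole algebra. -/
theorem lieSubalgebra_eq_top (K : LieSubalgebra ℂ R.Algebra) (hh : ∀ x, R.cartan x ∈ K)
    (he : ∀ i, R.chevalleyE i ∈ K) (hf : ∀ i, R.chevalleyF i ∈ K) : K = ⊤ := by
  have hgen (g : Gen ι 𝔥) : R.proj (FreeLieAlgebra.of ℂ g) ∈ K := by
    cases g with
    | h x => exact hh x
    | e i => exact he i
    | f i => exact hf i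
  have hlift : K.incl.comp (FreeLieAlgebra.lift ℂ fun g => (⟨_, hgen g⟩ : K)) = R.proj := by
    ext g
    simp
  refine eq_top_iff.2 fun y _ => ?_
  obtain ⟨z, rfl⟩ := R.proj_surjective y
  rw [← hlift]
  exact SetLike.coe_mem _

/-- A subspace of `g(A)` that contains the generators and is stable under bracketing with them
is the whole algebra. -/
theorem submodule_eq_top (S : Submodule ℂ R.Algebra)
    (hh : ∀ x, R.cartan x ∈ S) (he : ∀ i, R.chevalleyE i ∈ S) (hf : ∀ i, R.chevalleyF i ∈ S)
    (hhS : ∀ x, ∀ y ∈ S, ⁅R.cartan x, y⁆ ∈ S) (heS : ∀ i, ∀ y ∈ S, ⁅R.chevalleyE i, y⁆ ∈ S)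
    (hfS : ∀ i, ∀ y ∈ S, ⁅R.chevalleyF i, y⁆ ∈ S) : S = ⊤ := by
  -- The elements whose bracket preserves `S` form a subalgebra by the Jacobi identity. It contains
  -- the generators, so `S` is an ideal, hence itself a subalgebra containing the generators.
  let N : LieSubalgebra ℂ R.Algebra :=
    { carrier := {x | ∀ y ∈ S, ⁅x, y⁆ ∈ S}
      add_mem' := fun hx hx' y hy => by
        rw [add_lie]
        exact S.add_mem (hx y hy) (hx' y hy)
      zero_mem' := fun y _ => by
        rw [zero_lie]
        exact S.zero_mem
      smul_mem' := fun c x hx y hy => by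
        rw [smul_lie]
        exact S.smul_mem c (hx y hy)
      lie_mem' := fun hx hx' y hy => by
        rw [lie_lie]
        exact S.sub_mem (hx _ (hx' y hy)) (hx' _ (hx y hy)) }
  have hN : N = ⊤ := R.lieSubalgebra_eq_top N hhS heS hfS
  have hideal (x : R.Algebra) : ∀ y ∈ S, ⁅x, y⁆ ∈ S := by
    have hx : x ∈ N := hN ▸ LieSubalgebra.mem_top x
    exact hx
  let K : LieSubalgebra ℂ R.Algebra := { S with lie_mem' := fun {x y} _ hy => hideal x y hy }
  have hK : K = ⊤ := R.lieSubalgebra_eq_top K hh he hf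
  refine eq_top_iff.2 fun y _ => ?_
  have hy : y ∈ K := hK ▸ LieSubalgebra.mem_top y
  exact hy

/-! ### Root spaces -/

theorem lie_mem_rootSpace {β γ : Module.Dual ℂ 𝔥} {x y : R.Algebra} (hx : x ∈ R.rootSpace β)
    (hy : y ∈ R.rootSpace γ) : ⁅x, y⁆ ∈ R.rootSpace (β + γ) := by
  intro h
  rw [leibniz_lie, hx h, hy h, smul_lie, lie_smul, LinearMap.add_apply, add_smul]

theorem cartan_mem_rootSpace (x : 𝔥) : R.cartan x ∈ R.rootSpace 0 := fun h => by
  rw [cartan_lie_cartan, LinearMap.zero_apply, zero_smul]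

theorem chevalleyE_mem_rootSpace (i : ι) : R.chevalleyE i ∈ R.rootSpace (R.simpleRoot i) :=
  fun h => R.cartan_lie_chevalleyE h i

theorem chevalleyF_mem_rootSpace (i : ι) : R.chevalleyF i ∈ R.rootSpace (-R.simpleRoot i) :=
  fun h => by rw [cartan_lie_chevalleyF, LinearMap.neg_apply, neg_smul]

theorem iSupIndep_rootSpace : iSupIndep R.rootSpace :=
  iSupIndep_of_lie_eq_smul R.cartan R.cartan_lie_cartan R.rootSpace fun _ _ hx => hx

theorem weightedWord_mem_rootSpace {a : ι → Module.Dual ℂ 𝔥} {x : ι → R.Algebra}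
    (hx : ∀ i, x i ∈ R.rootSpace (a i)) {γ : Module.Dual ℂ 𝔥} {w : R.Algebra}
    (hw : WeightedWord a x γ w) : w ∈ R.rootSpace γ := by
  induction hw with
  | letter i => exact hx i
  | lie i _ ih => exact R.lie_mem_rootSpace (hx i) ih

/-! ### The triangular decomposition -/

/-- The linear span of the right normed words in the `x i`. -/
def wordSpan (a : ι → Module.Dual ℂ 𝔥) (x : ι → R.Algebra) : Submodule ℂ R.Algebra :=
  Submodule.span ℂ {w | ∃ γ, WeightedWord a x γ w}

theorem lie_mem_wordSpan {a : ι → Module.Dual ℂ 𝔥} {x : ι → R.Algebra} (i : ι) {w : R.Algebra}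
    (hw : w ∈ R.wordSpan a x) : ⁅x i, w⁆ ∈ R.wordSpan a x := by
  refine lie_mem_of_mem_span ?_ hw
  rintro w ⟨γ, hw⟩
  exact Submodule.subset_span ⟨_, hw.lie i⟩

theorem cartan_lie_mem_wordSpan {a : ι → Module.Dual ℂ 𝔥} {x : ι → R.Algebra}
    (hx : ∀ i, x i ∈ R.rootSpace (a i)) (h : 𝔥) {w : R.Algebra} (hw : w ∈ R.wordSpan a x) :
    ⁅R.cartan h, w⁆ ∈ R.wordSpan a x := by
  refine lie_mem_of_mem_span ?_ hw
  rintro w ⟨γ, hw⟩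
  rw [R.weightedWord_mem_rootSpace hx hw h]
  exact Submodule.smul_mem _ _ (Submodule.subset_span ⟨_, hw⟩)

theorem lie_cartan_mem_wordSpan {a : ι → Module.Dual ℂ 𝔥} {x : ι → R.Algebra}
    (hx : ∀ i, x i ∈ R.rootSpace (a i)) (i : ι) {h : R.Algebra}
    (hh : h ∈ Submodule.span ℂ (Set.range R.cartan)) : ⁅x i, h⁆ ∈ R.wordSpan a x := by
  refine lie_mem_of_mem_span ?_ hh
  rintro _ ⟨h, rfl⟩
  rw [← lie_skew, hx i h]
  exact Submodule.neg_mem _ (Submodule.smul_mem _ _ (Submodule.subset_span ⟨_, .letter i⟩))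

theorem cartanSpan_lie_mem_wordSpan {a : ι → Module.Dual ℂ 𝔥} {x : ι → R.Algebra}
    (hx : ∀ i, x i ∈ R.rootSpace (a i)) {h w : R.Algebra}
    (hh : h ∈ Submodule.span ℂ (Set.range R.cartan)) (hw : w ∈ R.wordSpan a x) :
    ⁅h, w⁆ ∈ R.wordSpan a x := by
  induction hh using Submodule.span_induction with
  | mem _ hh =>
    obtain ⟨h, rfl⟩ := hh
    exact R.cartan_lie_mem_wordSpan hx h hw
  | zero => simp
  | add _ _ _ _ h₁ h₂ => rw [add_lie]; exact Submodule.add_mem _ h₁ h₂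
  | smul c _ _ h => rw [smul_lie]; exact Submodule.smul_mem _ c h

/-- By Leibniz, `y i` meets each letter in turn and leaves an element of the span of `𝔥`, which
preserves the word span. The summand from `𝔥` itself arises only from one-letter words. Stated for
abstract `x`, `y` so as to serve both `e` against `f` and `f` against `e`. -/
theorem lie_opposite_mem {a : ι → Module.Dual ℂ 𝔥} {x y : ι → R.Algebra}
    (hx : ∀ i, x i ∈ R.rootSpace (a i))
    (hyx : ∀ i j, ⁅y i, x j⁆ ∈ Submodule.span ℂ (Set.range R.cartan)) (i : ι) {w : R.Algebra}
    (hw : w ∈ R.wordSpan a x) :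
    ⁅y i, w⁆ ∈ Submodule.span ℂ (Set.range R.cartan) ⊔ R.wordSpan a x := by
  refine lie_mem_of_mem_span ?_ hw
  rintro w ⟨γ, hw⟩
  induction hw with
  | letter j => exact Submodule.mem_sup_left (hyx i j)
  | lie j hw ih =>
    rw [leibniz_lie]
    refine Submodule.mem_sup_right (Submodule.add_mem _
      (R.cartanSpan_lie_mem_wordSpan hx (hyx i j) (Submodule.subset_span ⟨_, hw⟩)) ?_)
    obtain ⟨h, hh, v, hv, hsum⟩ := Submodule.mem_sup.1 ih
    rw [← hsum, lie_add]
    exact Submodule.add_mem _ (R.lie_cartan_mem_wordSpan hx j hh) (R.lie_mem_wordSpan j hv)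

/-- The triangular decomposition: `g(A)` is spanned by `𝔥`, the words in the `e i` and the words
in the `f i`. -/
theorem cartan_sup_wordSpan_eq_top :
    Submodule.span ℂ (Set.range R.cartan) ⊔ R.wordSpan R.simpleRoot R.chevalleyE ⊔
      R.wordSpan (fun i => -R.simpleRoot i) R.chevalleyF = ⊤ := by
  have hE := R.chevalleyE_mem_rootSpace
  have hF := R.chevalleyF_mem_rootSpace
  set H := Submodule.span ℂ (Set.range R.cartan) with hH
  set P := R.wordSpan R.simpleRoot R.chevalleyE with hP
  set N := R.wordSpan (fun i => -R.simpleRoot i) R.chevalleyF with hN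
  have leH : H ≤ H ⊔ P ⊔ N := le_sup_left.trans le_sup_left
  have leP : P ≤ H ⊔ P ⊔ N := le_sup_right.trans le_sup_left
  have leN : N ≤ H ⊔ P ⊔ N := le_sup_right
  have leHN : H ⊔ N ≤ H ⊔ P ⊔ N := sup_le leH leN
  have hHH (x : 𝔥) (y : R.Algebra) (hy : y ∈ H) : ⁅R.cartan x, y⁆ ∈ H := by
    refine lie_mem_of_mem_span ?_ hy
    rintro _ ⟨y, rfl⟩
    rw [cartan_lie_cartan]
    exact H.zero_mem
  have key (z : R.Algebra) (h₁ : ∀ y ∈ H, ⁅z, y⁆ ∈ H ⊔ P ⊔ N)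
      (h₂ : ∀ y ∈ P, ⁅z, y⁆ ∈ H ⊔ P ⊔ N) (h₃ : ∀ y ∈ N, ⁅z, y⁆ ∈ H ⊔ P ⊔ N) :
      ∀ y ∈ H ⊔ P ⊔ N, ⁅z, y⁆ ∈ H ⊔ P ⊔ N := by
    intro y hy
    obtain ⟨u, hu, n, hn, rfl⟩ := Submodule.mem_sup.1 hy
    obtain ⟨h, hh, p, hp, rfl⟩ := Submodule.mem_sup.1 hu
    rw [lie_add, lie_add]
    exact Submodule.add_mem _ (Submodule.add_mem _ (h₁ h hh) (h₂ p hp)) (h₃ n hn)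
  refine R.submodule_eq_top _ (fun x => leH (Submodule.subset_span ⟨x, rfl⟩))
    (fun i => leP (Submodule.subset_span ⟨_, .letter i⟩))
    (fun i => leN (Submodule.subset_span ⟨_, .letter i⟩))
    (fun x => key _ (fun y hy => leH (hHH x y hy))
      (fun y hy => leP (R.cartan_lie_mem_wordSpan hE x hy))
      fun y hy => leN (R.cartan_lie_mem_wordSpan hF x hy))
    (fun i => key _ (fun y hy => leP (R.lie_cartan_mem_wordSpan hE i hy))
      (fun y hy => leP (R.lie_mem_wordSpan i hy))
      fun y hy => leHN (R.lie_opposite_mem hF R.chevalleyE_lie_chevalleyF_mem i hy))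
    (fun i => key _ (fun y hy => leN (R.lie_cartan_mem_wordSpan hF i hy))
      (fun y hy => le_sup_left (a := H ⊔ P) (b := N) (R.lie_opposite_mem hE R.chevalleyF_lie_chevalleyE_mem i hy))
      fun y hy => leN (R.lie_mem_wordSpan i hy))

/-- The root space of a nonzero weight in the positive cone is spanned by the words in the `e i`
of that weight. -/
theorem rootSpace_eq_span_words (c : ι → ℕ) (hc : ∑ i, c i • R.simpleRoot i ≠ 0) :
    R.rootSpace (∑ i, c i • R.simpleRoot i) = Submodule.span ℂ
      {w | WeightedWord R.simpleRoot R.chevalleyE (∑ i, c i • R.simpleRoot i) w} := by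
  -- The part of the spanning set of the triangular decomposition that has weight `γ`.
  let W (γ : Module.Dual ℂ 𝔥) : Submodule ℂ R.Algebra := Submodule.span ℂ
    ({w | w ∈ Set.range R.cartan ∧ γ = 0} ∪ {w | WeightedWord R.simpleRoot R.chevalleyE γ w} ∪
      {w | WeightedWord (fun i => -R.simpleRoot i) R.chevalleyF γ w})
  have hWle : W ≤ R.rootSpace := by
    intro γ
    refine Submodule.span_le.2 ?_
    rintro w ((⟨⟨x, rfl⟩, rfl⟩ | hw) | hw)
    · exact R.cartan_mem_rootSpace x
    · exact R.weightedWord_mem_rootSpace R.chevalleyE_mem_rootSpace hw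
    · exact R.weightedWord_mem_rootSpace R.chevalleyF_mem_rootSpace hw
  have hWtop : ⨆ γ, W γ = ⊤ := by
    rw [eq_top_iff, ← R.cartan_sup_wordSpan_eq_top]
    refine sup_le (sup_le ?_ ?_) ?_ <;> refine Submodule.span_le.2 ?_
    · exact fun w hw => Submodule.mem_iSup_of_mem 0 (Submodule.subset_span (.inl (.inl ⟨hw, rfl⟩)))
    · rintro w ⟨γ, hw⟩
      exact Submodule.mem_iSup_of_mem γ (Submodule.subset_span (.inl (.inr hw)))
    · rintro w ⟨γ, hw⟩
      exact Submodule.mem_iSup_of_mem γ (Submodule.subset_span (.inr hw))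
  -- Subspaces of an independent family that together span everything must fill it.
  rw [← (R.iSupIndep_rootSpace.le_iff_eq_of_iSup_eq_top hWtop).1 hWle]
  refine le_antisymm (Submodule.span_mono ?_) (Submodule.span_mono fun w hw => .inl (.inr hw))
  rintro w ((⟨-, h⟩ | hw) | hw)
  · exact absurd h hc
  · exact hw
  -- An `f`-word has weight `-∑ d i • α i`, so `c + d = 0` by independence of the simple roots,
  -- which forces `d = 0`.
  · obtain ⟨d, hd, hsum⟩ := hw.exists_weight_eq_sum
    refine absurd (funext fun i => ?_) hd
    have hzero : ∑ i, ((c i + d i : ℕ) : ℂ) • R.simpleRoot i = 0 := by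
      simp only [Nat.cast_smul_eq_nsmul, add_smul, Finset.sum_add_distrib, hsum, smul_neg,
        Finset.sum_neg_distrib, neg_add_cancel]
    have := Fintype.linearIndependent_iff.1 R.linearIndependent_simpleRoot _ hzero i
    norm_cast at this
    exact (Nat.add_eq_zero_iff.1 this).2

/-! ### Words in elements of `I`-height one -/

variable (I : Finset ι)

theorem heightOn_add {x y : Module.Dual ℂ 𝔥} (hx : x ∈ Submodule.span ℂ (Set.range R.simpleRoot))
    (hy : y ∈ Submodule.span ℂ (Set.range R.simpleRoot)) :
    R.heightOn I (x + y) = R.heightOn I x + R.heightOn I y := by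
  obtain ⟨c, rfl⟩ := (Submodule.mem_span_range_iff_exists_fun ℂ).1 hx
  obtain ⟨d, rfl⟩ := (Submodule.mem_span_range_iff_exists_fun ℂ).1 hy
  simp only [← Finset.sum_add_distrib, ← add_smul, heightOn_sum]

open Classical in
theorem heightOn_simpleRoot (i : ι) : R.heightOn I (R.simpleRoot i) = if i ∈ I then 1 else 0 := by
  have h : R.simpleRoot i = ∑ j, (if i = j then (1 : ℂ) else 0) • R.simpleRoot j := by simp
  rw [h, heightOn_sum, Finset.sum_ite_eq]

theorem heightOn_zero : R.heightOn I 0 = 0 := by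
  simpa using R.heightOn_sum I 0

theorem simpleRoot_mem_span (i : ι) :
    R.simpleRoot i ∈ Submodule.span ℂ (Set.range R.simpleRoot) :=
  Submodule.subset_span ⟨i, rfl⟩

/-- Weights of `I`-height one in the span of the simple roots. -/
def unitWeights : Set (Module.Dual ℂ 𝔥) :=
  {γ | γ ∈ Submodule.span ℂ (Set.range R.simpleRoot) ∧ R.heightOn I γ = 1}

/-- Right normed words in `m` weight vectors of `I`-height one, together with their weights. -/
inductive UnitWord : ℕ → Module.Dual ℂ 𝔥 → R.Algebra → Prop
  | letter {γ : Module.Dual ℂ 𝔥} {x : R.Algebra} :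
      γ ∈ R.unitWeights I → x ∈ R.rootSpace γ → UnitWord 1 γ x
  | lie {m : ℕ} {γ δ : Module.Dual ℂ 𝔥} {x y : R.Algebra} :
      γ ∈ R.unitWeights I → x ∈ R.rootSpace γ → UnitWord m δ y → UnitWord (m + 1) (γ + δ) ⁅x, y⁆

variable {I}

theorem simpleRoot_mem_unitWeights {i : ι} (hi : i ∈ I) : R.simpleRoot i ∈ R.unitWeights I :=
  ⟨R.simpleRoot_mem_span i, by rw [heightOn_simpleRoot, if_pos hi]⟩

theorem simpleRoot_add_mem_unitWeights {i : ι} (hi : i ∉ I) {γ : Module.Dual ℂ 𝔥}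
    (hγ : γ ∈ R.unitWeights I) : R.simpleRoot i + γ ∈ R.unitWeights I :=
  ⟨Submodule.add_mem _ (R.simpleRoot_mem_span i) hγ.1, by
    rw [heightOn_add _ _ (R.simpleRoot_mem_span i) hγ.1, heightOn_simpleRoot, if_neg hi, hγ.2,
      zero_add]⟩

/-- Regrouping uses weights that are not known to be roots; a nonzero vector of such a weight
certifies that it is one. -/
theorem mem_unitRoots {γ : Module.Dual ℂ 𝔥} (hγ : γ ∈ R.unitWeights I) {x : R.Algebra}
    (hx : x ∈ R.rootSpace γ) (hx0 : x ≠ 0) : γ ∈ R.unitRoots I := by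
  refine ⟨⟨?_, fun h => hx0 ?_⟩, hγ.2⟩
  · rintro rfl
    exact zero_ne_one ((R.heightOn_zero I).symm.trans hγ.2)
  · rwa [h, Submodule.mem_bot] at hx

/-- `ad (e i)` is a derivation, so it yields a sum of words with one letter changed each; for `i ∉
I` the changed letter still has height one, and the length stays `m`. -/
theorem chevalleyE_lie_unitWord {i : ι} (hi : i ∉ I) {m : ℕ} {δ : Module.Dual ℂ 𝔥} {y : R.Algebra}
    (hy : R.UnitWord I m δ y) :
    ⁅R.chevalleyE i, y⁆ ∈ Submodule.span ℂ {z | R.UnitWord I m (R.simpleRoot i + δ) z} := by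
  induction hy with
  | letter hγ hx =>
    exact Submodule.subset_span (.letter (R.simpleRoot_add_mem_unitWeights hi hγ)
      (R.lie_mem_rootSpace (R.chevalleyE_mem_rootSpace i) hx))
  | @lie m γ δ x y hγ hx hy ih =>
    rw [leibniz_lie]
    refine Submodule.add_mem _ (Submodule.subset_span ?_) ?_
    · change R.UnitWord I _ _ _
      rw [← add_assoc]
      exact .lie (R.simpleRoot_add_mem_unitWeights hi hγ)
        (R.lie_mem_rootSpace (R.chevalleyE_mem_rootSpace i) hx) hy
    · refine lie_mem_of_mem_span (fun z hz => Submodule.subset_span ?_) ih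
      change R.UnitWord I _ _ _
      rw [add_left_comm]
      exact .lie hγ hx hz

/-- A word in the `e i` in which `m > 0` letters have their index in `I` is a linear combination
of words in `m` elements of `I`-height one. -/
theorem weightedWord_mem_span_unitWord {γ : Module.Dual ℂ 𝔥} {w : R.Algebra}
    (hw : WeightedWord R.simpleRoot R.chevalleyE γ w) :
    γ ∈ Submodule.span ℂ (Set.range R.simpleRoot) ∧ ∃ m : ℕ, R.heightOn I γ = m ∧
      (0 < m → w ∈ Submodule.span ℂ {z | R.UnitWord I m γ z}) := by
  induction hw with
  | letter i =>
    refine ⟨R.simpleRoot_mem_span i, ?_⟩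
    by_cases hi : i ∈ I
    · exact ⟨1, by rw [heightOn_simpleRoot, if_pos hi, Nat.cast_one], fun _ => Submodule.subset_span
        (.letter (R.simpleRoot_mem_unitWeights hi) (R.chevalleyE_mem_rootSpace i))⟩
    · exact ⟨0, by rw [heightOn_simpleRoot, if_neg hi, Nat.cast_zero], fun h => absurd h (lt_irrefl 0)⟩
  | @lie i γ w hw ih =>
    obtain ⟨hγ, m, hm, hspan⟩ := ih
    have hadd := R.heightOn_add I (R.simpleRoot_mem_span i) hγ
    have hmem := Submodule.add_mem _ (R.simpleRoot_mem_span i) hγ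
    refine ⟨hmem, ?_⟩
    by_cases hi : i ∈ I
    · rw [heightOn_simpleRoot, if_pos hi, hm] at hadd
      refine ⟨m + 1, by rw [hadd, Nat.cast_add, Nat.cast_one, add_comm], fun _ => ?_⟩
      -- At height zero the inner word is not yet regrouped: the whole bracket with `e i` becomes
      -- the first letter.
      rcases m.eq_zero_or_pos with rfl | hpos
      · refine Submodule.subset_span (.letter ⟨hmem, by rw [hadd, Nat.cast_zero, add_zero]⟩ ?_)
        exact R.lie_mem_rootSpace (R.chevalleyE_mem_rootSpace i)
          (R.weightedWord_mem_rootSpace R.chevalleyE_mem_rootSpace hw)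
      · exact lie_mem_of_mem_span (fun z hz => Submodule.subset_span
          (.lie (R.simpleRoot_mem_unitWeights hi) (R.chevalleyE_mem_rootSpace i) hz)) (hspan hpos)
    · rw [heightOn_simpleRoot, if_neg hi, hm, zero_add] at hadd
      refine ⟨m, hadd, fun hpos => ?_⟩
      exact lie_mem_of_mem_span (fun z hz => R.chevalleyE_lie_unitWord hi hz) (hspan hpos)

theorem unitWord_length_ne_zero {m : ℕ} {β : Module.Dual ℂ 𝔥} {x : R.Algebra}
    (hx : R.UnitWord I m β x) : m ≠ 0 := by
  induction hx with
  | letter => exact one_ne_zero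
  | @lie m => exact m.succ_ne_zero

/-- The alternative `x = 0` absorbs the words having a zero letter, whose weight may fail to be a
root. -/
theorem UnitWord.eq_zero_or_exists {m : ℕ} {β : Module.Dual ℂ 𝔥} {x : R.Algebra}
    (hx : R.UnitWord I m β x) :
    x = 0 ∨ ∃ (γ : Fin m → Module.Dual ℂ 𝔥) (e : Fin m → R.Algebra),
      (∀ t, γ t ∈ R.unitRoots I) ∧ (∀ t, e t ∈ R.rootSpace (γ t)) ∧
      ∑ t, γ t = β ∧ x = rightNormedWord m e := by
  induction hx with
  | @letter γ x hγ hx =>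
    refine or_iff_not_imp_left.2 fun hx0 => ?_
    exact ⟨fun _ => γ, fun _ => x, fun _ => R.mem_unitRoots hγ hx hx0, fun _ => hx, by simp, rfl⟩
  | @lie m γ δ x y hγ hx hy ih =>
    rcases eq_or_ne x 0 with rfl | hx0
    · exact .inl (zero_lie y)
    rcases ih with rfl | ⟨γ', e, hγ', he, hsum, rfl⟩
    · exact .inl (lie_zero x)
    -- `rightNormedWord` unfolds to a bracket only at lengths `k + 2`, so the inner word must have
    -- successor length. The outer letter carries the last index, hence `Fin.snoc`.
    obtain ⟨k, rfl⟩ := Nat.exists_eq_succ_of_ne_zero (R.unitWord_length_ne_zero hy)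
    refine .inr ⟨Fin.snoc γ' γ, Fin.snoc e x, fun t => ?_, fun t => ?_, ?_, ?_⟩
    · refine Fin.lastCases ?_ (fun t => ?_) t
      · rw [Fin.snoc_last]
        exact R.mem_unitRoots hγ hx hx0
      · rw [Fin.snoc_castSucc]
        exact hγ' t
    · refine Fin.lastCases ?_ (fun t => ?_) t
      · rw [Fin.snoc_last, Fin.snoc_last]
        exact hx
      · rw [Fin.snoc_castSucc, Fin.snoc_castSucc]
        exact he t
    · rw [Fin.sum_snoc, hsum, add_comm]
    · simp only [rightNormedWord, Fin.snoc_last, Fin.snoc_castSucc]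

theorem rightNormedWord_mem_rootSpace :
    ∀ {m : ℕ} {γ : Fin m → Module.Dual ℂ 𝔥} {e : Fin m → R.Algebra},
      (∀ t, e t ∈ R.rootSpace (γ t)) → rightNormedWord m e ∈ R.rootSpace (∑ t, γ t)
  | 0, _, _, _ => Submodule.zero_mem _
  | 1, γ, e, he => by
    rw [Fin.sum_univ_one]
    exact he 0
  | m + 2, γ, e, he => by
    rw [Fin.sum_univ_castSucc, add_comm]
    exact R.lie_mem_rootSpace (he _) (rightNormedWord_mem_rootSpace fun t => he t.castSucc)

end Realization

end KacMoody

end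

theorem mainTheorem6 {ι : Type*} [Fintype ι] (A : Matrix ι ι ℤ)
    (hA : KacMoody.IsFiniteType A ∨ KacMoody.IsAffineType A)
    {𝔥 : Type*} [AddCommGroup 𝔥] [Module ℂ 𝔥] (R : KacMoody.Realization A 𝔥)
    (I : Finset ι) (hI : I.Nonempty)
    (β : Module.Dual ℂ 𝔥) (hβ : β ∈ R.posRoots)
    (m : ℕ) (hm : R.heightOn I β = (m : ℂ)) (hm_pos : 0 < m) :
    R.rootSpace β = Submodule.span ℂ
      {x : R.Algebra | ∃ (γ : Fin m → Module.Dual ℂ 𝔥) (e : Fin m → R.Algebra),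
        (∀ t, γ t ∈ R.unitRoots I) ∧ (∀ t, e t ∈ R.rootSpace (γ t)) ∧
        ∑ t, γ t = β ∧ x = KacMoody.rightNormedWord m e} := by
  refine le_antisymm ?_ (Submodule.span_le.2 ?_)
  · obtain ⟨⟨hβ0, -⟩, c, rfl⟩ := hβ
    rw [R.rootSpace_eq_span_words c hβ0]
    refine Submodule.span_le.2 fun w hw => ?_
    obtain ⟨-, n, hn, hspan⟩ := R.weightedWord_mem_span_unitWord (I := I) hw
    -- The height is complex-valued; it determines the number of letters because `ℂ` has
    -- characteristic zero.
    obtain rfl : n = m := Nat.cast_injective (R := ℂ) (hn.symm.trans hm)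
    refine Submodule.span_le.2 (fun z hz => ?_) (hspan hm_pos)
    rcases hz.eq_zero_or_exists with rfl | h
    · exact Submodule.zero_mem _
    · exact Submodule.subset_span h
  · rintro x ⟨γ, e, -, he, rfl, rfl⟩
    exact R.rightNormedWord_mem_rootSpace he
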